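/- **Data rate theorem.** Let $\Sigma=(X,U,F)$ be a system, i.e. $X$, $U$ are nonempty sets and $F$ assigns to each $(x,u)\in X\times U$ a nonempty set $F(x,u)\subseteq X$; for $A\subseteq X$ put $F(A,u)=\bigcup_{x\in A}F(x,u)$. Let $Q\subseteq X$ be nonempty. For integers write $[a;b)=\{a,\dots,b-1\}$, $[a;b]=\{a,\dots,b\}$, and let $\#$ denote cardinality. Let $\mathcal B(\Sigma)$ be the set of pairs $(\xi,\nu)$ of sequences $\xi:\mathbb Z_{\ge0}\to X$, $\nu:\mathbb Z_{\ge0}\to U$ with $\xi(t+1)\in F(\xi(t),\nu(t))$ for all $t\ge 0$. *Invariance feedback entropy.* An invariant cover $(\mathcal A,G)$ of $\Sigma$ and $Q$ is a finite set $\mathcal A$ of subsets of $Q$ whose union is $Q$, with a map $G:\mathcal A\to U$ such that $F(A,G(A))\subseteq Q$ for all $A\in\mathcal A$. For $\tau\in\mathbb N=\{1,2,\dots\}$, $\mathcal S\subseteq\mathcal A^{[0;\tau)}$ and $\alpha\in\mathcal S$ let $P(\alpha|_{[0;t]})=\{\hat\alpha(t+1)\mid \hat\alpha\in\mathcal S,\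 \hat\alpha|_{[0;t]}=\alpha|_{[0;t]}\}$ for $0\le t<\tau-1$, and $P(\alpha|_{[0;\tau-1]})=P(\alpha)=\{\hat\alpha(0)\mid\hat\alpha\in\mathcal S\}$. The set $\mathcal S$ is $(\tau,Q)$-spanning if $\{\hat\alpha(0)\mid\hat\alpha\in\mathcal S\}$ covers $Q$ and $F(\alpha(t),G(\alpha(t)))\subseteq\bigcup_{A'\in P(\alpha|_{[0;t]})}A'$ for all $\alpha\in\mathcal S$, $0\le t<\tau-1$. Put $$N(\mathcal S)=\max_{\alpha\in\mathcal S}\prod_{t=0}^{\tau-1}\#P(\alpha|_{[0;t]}),\qquad r_{\rm inv}(\tau,Q)=\min\{N(\mathcal S)\mid \mathcal S\ (\tau,Q)\text{-spanning}\},$$ $$h(\mathcal A,G)=\lim_{\tau\to\infty}\tfrac1\tau\log_2 r_{\rm inv}(\tau,Q),\qquad h_{\rm inv}=\inf_{(\mathcal A,G)}h(\mathcal A,G),$$ where the limit always exists, the infimum is over all invariant covers of $\Sigma$ and $Q$, and $\inf\emptyset=\infty$. *Coder-controllers.* A coder-controller is a triple $H=(S,\gamma,\delta)$ with a finite set $S$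 and maps $\gamma:\bigcup_{t\ge0}X^{[0;t]}\to S$, $\delta:\bigcup_{t\ge0}S^{[0;t]}\to U$. For $\xi\in X^{[0;t]}$ let $\Gamma_t(\xi)\in S^{[0;t]}$ be given by $\Gamma_t(\xi)(t')=\gamma(\xi|_{[0;t']})$. $H$ is $Q$-admissible if every $(\xi,\nu)\in\mathcal B(\Sigma)$ with $\xi(0)\in Q$ and $\nu(t)=\delta(\Gamma_t(\xi|_{[0;t]}))$ for all $t\ge0$ satisfies $\xi(t)\in Q$ for all $t\ge 0$. For $\zeta\in S^{[0;t)}$ with $t\ge1$ let $Z(\zeta)$ be the set of $s\in S$ for which there is $(\xi,\nu)\in\mathcal B(\Sigma)$ with $\zeta s=\Gamma_t(\xi|_{[0;t]})$ and $\nu(t')=\delta(\zeta|_{[0;t']})$ for all $t'\in[0;t)$; put $Z(\emptyset)=S$. Let $\mathcal Z_\tau$ be the set of $\zeta\in S^{[0;\tau)}$ with $\zeta(0)\in\gamma(X)$ and $\zeta(t)\in Z(\zeta|_{[0;t)})$ for $0<t<\tau$. The transmission data rate of $H$ is $$R(H)=\limsup_{\tau\to\infty}\ \max_{\zeta\in\mathcal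 Z_\tau}\frac1\tau\sum_{t=0}^{\tau-1}\log_2\#Z(\zeta|_{[0;t)}).$$ *Theorem.* The invariance feedback entropy of $\Sigma$ and $Q$ satisfies $$h_{\rm inv}=\inf_{H\in\mathcal H}R(H),$$ where $\mathcal H$ is the set of all $Q$-admissible coder-controllers for $\Sigma$ (both sides may be $\infty$). -/

import Mathlib

open Filter Topology

universe w u v

/-- An uncertain control system with state alphabet `X`, input alphabet `U` and a strict
set-valued transition function `F`. -/
structure ControlSystem (X U : Type*) where
  F : X → U → Set X
  strict : ∀ x u, (F x u).Nonempty

/-- The restriction of a finite sequence of length `n` to its first `m` entries. -/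
def restrict {α : Type*} {n : ℕ} (x : Fin n → α) (m : ℕ) (h : m ≤ n) : Fin m → α :=
  fun i => x (Fin.castLE h i)

namespace ControlSystem

variable {X U : Type*}

/-- The set of all infinite trajectories `(ξ, ν)` of the system. -/
def behavior (sys : ControlSystem X U) : Set ((ℕ → X) × (ℕ → U)) :=
  {p | ∀ t, p.1 (t + 1) ∈ sys.F (p.1 t) (p.2 t)}

end ControlSystem

/-- An invariant cover `(𝒜, G)` of a system and a set `Q`: a finite set `𝒜` of subsets of `Q`
that covers `Q`, and a map `G : 𝒜 → U` with `F(A, G(A)) ⊆ Q` for all `A ∈ 𝒜`. -/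
structure InvariantCover {X U : Type*} (sys : ControlSystem X U) (Q : Set X) where
  sets : Set (Set X)
  G : sets → U
  finite : sets.Finite
  subset : ∀ A ∈ sets, A ⊆ Q
  covers : Q ⊆ ⋃₀ sets
  invariant : ∀ A : sets, (⋃ x ∈ A.1, sys.F x (G A)) ⊆ Q

namespace InvariantCover

variable {X U : Type*} {sys : ControlSystem X U} {Q : Set X} (C : InvariantCover sys Q) {τ : ℕ}

/-- The set of first elements of the sequences in `S`. -/
def initial (S : Set (Fin τ → C.sets)) : Set C.sets :=
  {A | ∃ β ∈ S, ∃ h : 0 < τ, A = β ⟨0, h⟩}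

/-- The set `P(α|[0;t])`. For `t < τ - 1` it consists of the cover elements by which `α|[0;t]` can
be extended to (a prefix of) a sequence in `S`; for `t = τ - 1` it is the set of initial
elements. -/
def succ (S : Set (Fin τ → C.sets)) (α : Fin τ → C.sets) (t : Fin τ) : Set C.sets :=
  {A | (∃ h : t.1 + 1 < τ, ∃ β ∈ S, (∀ i ≤ t, β i = α i) ∧ A = β ⟨t.1 + 1, h⟩) ∨
    (t.1 + 1 = τ ∧ A ∈ C.initial S)}

/-- `S ⊆ 𝒜^[0;τ)` is `(τ, Q)`-spanning in `(𝒜, G)`. -/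
def IsSpanning (S : Set (Fin τ → C.sets)) : Prop :=
  Q ⊆ (⋃ A ∈ C.initial S, A.1) ∧
    ∀ α ∈ S, ∀ t : Fin τ, t.1 + 1 < τ →
      (⋃ x ∈ (α t).1, sys.F x (C.G (α t))) ⊆ ⋃ A ∈ C.succ S α t, A.1

/-- The expansion number `N(S)`, the maximum over `α ∈ S` of `∏ t, #P(α|[0;t])`. The set `𝒜` is
finite, so for nonempty `S` the supremum is a maximum. -/
noncomputable def expansion (S : Set (Fin τ → C.sets)) : ℕ :=
  ⨆ α : S, ∏ t : Fin τ, (C.succ S α.1 t).ncard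

/-- `r_inv(τ, Q)`, the smallest expansion number of a `(τ, Q)`-spanning set in `(𝒜, G)`. -/
noncomputable def rInv (τ : ℕ) : ℕ :=
  sInf {N | ∃ S : Set (Fin τ → C.sets), C.IsSpanning S ∧ N = C.expansion S}

/-- The entropy `h(𝒜, G)`; the limit exists for nonempty `Q` by `tendsto_entropy` below. -/
noncomputable def entropy : ℝ :=
  limUnder atTop (fun τ : ℕ => (1 / (τ : ℝ)) * Real.logb 2 (C.rInv τ))

theorem exists_spanning (hτ : 0 < τ) :
    ∃ S : Set (Fin τ → C.sets), C.IsSpanning S ∧ C.rInv τ = C.expansion S := by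
  have h : {N | ∃ S : Set (Fin τ → C.sets), C.IsSpanning S ∧ N = C.expansion S}.Nonempty := by
    refine ⟨_, Set.univ, ⟨fun x hx => ?_, fun α _ t ht y hy => ?_⟩, rfl⟩
    · obtain ⟨A, hA, hxA⟩ := C.covers hx
      exact Set.mem_biUnion (x := (⟨A, hA⟩ : C.sets)) ⟨fun _ => ⟨A, hA⟩, trivial, hτ, rfl⟩ hxA
    · obtain ⟨A, hA, hyA⟩ := C.covers (C.invariant _ hy)
      refine Set.mem_biUnion (x := (⟨A, hA⟩ : C.sets))
        (Or.inl ⟨ht, fun i => if i ≤ t then α i else ⟨A, hA⟩, trivial, ?_, ?_⟩) hyA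
      · intro i hi
        simp [hi]
      · have : ¬ (⟨t.1 + 1, ht⟩ : Fin τ) ≤ t := by simp [Fin.le_def]
        simp [this]
  obtain ⟨S, hS, hN⟩ := Nat.sInf_mem h
  exact ⟨S, hS, hN⟩

theorem le_expansion (S : Set (Fin τ → C.sets)) (α : Fin τ → C.sets) (hα : α ∈ S) :
    ∏ t : Fin τ, (C.succ S α t).ncard ≤ C.expansion S := by
  have : Finite C.sets := C.finite
  exact le_ciSup (f := fun α : S => ∏ t : Fin τ, (C.succ S α.1 t).ncard)
    (Set.finite_range _).bddAbove ⟨α, hα⟩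

theorem IsSpanning.nonempty {C : InvariantCover sys Q} {S : Set (Fin τ → C.sets)}
    (hS : C.IsSpanning S) (hQ : Q.Nonempty) : S.Nonempty := by
  obtain ⟨x, hx⟩ := hQ
  obtain ⟨A, ⟨β, hβ, -⟩, -⟩ := Set.mem_iUnion₂.1 (hS.1 hx)
  exact ⟨β, hβ⟩

theorem rInv_pos (hQ : Q.Nonempty) (hτ : 0 < τ) : 0 < C.rInv τ := by
  have : Finite C.sets := C.finite
  obtain ⟨S, hS, hN⟩ := C.exists_spanning hτ
  obtain ⟨α, hα⟩ := hS.nonempty hQ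
  rw [hN]
  refine lt_of_lt_of_le (Finset.prod_pos fun t _ => ?_) (C.le_expansion S α hα)
  rw [Set.ncard_pos]
  by_cases h : t.1 + 1 < τ
  · exact ⟨_, Or.inl ⟨h, α, hα, fun _ _ => rfl, rfl⟩⟩
  · exact ⟨_, Or.inr ⟨by have := t.isLt; omega, α, hα, hτ, rfl⟩⟩

theorem rInv_add_le (hQ : Q.Nonempty) (m n : ℕ) :
    C.rInv (m + 1 + (n + 1)) ≤ C.rInv (m + 1) * C.rInv (n + 1) := by
  have : Finite C.sets := C.finite
  obtain ⟨S, hS, hN⟩ := C.exists_spanning (Nat.succ_pos m)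
  obtain ⟨T, hT, hM⟩ := C.exists_spanning (Nat.succ_pos n)
  obtain ⟨σ, hσ⟩ := hS.nonempty hQ
  obtain ⟨ρ, hρ⟩ := hT.nonempty hQ
  set R : Set (Fin (m + 1 + (n + 1)) → C.sets) :=
    {α | (fun i => α (Fin.castAdd (n + 1) i)) ∈ S ∧ (fun i => α (Fin.natAdd (m + 1) i)) ∈ T}
    with hR
  have hin : C.initial R = C.initial S := by
    ext A
    constructor
    · rintro ⟨β, hβ, h, rfl⟩
      exact ⟨_, hβ.1, Nat.succ_pos m, rfl⟩
    · rintro ⟨β, hβ, h, rfl⟩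
      refine ⟨Fin.append β ρ, ⟨by simpa using hβ, by simpa using hρ⟩, by omega, ?_⟩
      exact (Fin.append_left β ρ ⟨0, h⟩).symm
  have h1 : ∀ α ∈ R, ∀ t : Fin m, C.succ R α (Fin.castAdd (n + 1) t.castSucc) =
      C.succ S (fun i => α (Fin.castAdd (n + 1) i)) t.castSucc := by
    intro α hα t
    ext A
    have ht := t.isLt
    constructor
    · rintro (⟨h, β, hβ, hag, rfl⟩ | ⟨h, -⟩)
      · refine Or.inl ⟨by simp, _, hβ.1, fun i hi => hag _ ?_, rfl⟩
        simpa [Fin.le_def] using hi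
      · simp at h; omega
    · rintro (⟨h, β, hβ, hag, rfl⟩ | ⟨h, -⟩)
      · refine Or.inl ⟨by simp; omega, Fin.append β (fun i => α (Fin.natAdd (m + 1) i)),
          ⟨by simpa using hβ, by simpa using hα.2⟩, fun i hi => ?_, ?_⟩
        · have hi' : i.1 ≤ t.1 := by simpa [Fin.le_def] using hi
          have : i = Fin.castAdd (n + 1) (⟨i.1, by omega⟩ : Fin (m + 1)) := rfl
          rw [this, Fin.append_left]
          exact hag _ (by simpa [Fin.le_def] using hi')
        · exact (Fin.append_left β _ ⟨_, h⟩).symm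
      · simp at h; omega
  have h2 : ∀ α ∈ R, C.succ R α (Fin.castAdd (n + 1) (Fin.last m)) = C.initial T := by
    intro α hα
    ext A
    constructor
    · rintro (⟨h, β, hβ, hag, rfl⟩ | ⟨h, -⟩)
      · exact ⟨_, hβ.2, Nat.succ_pos n, rfl⟩
      · simp at h
    · rintro ⟨β, hβ, h, rfl⟩
      refine Or.inl ⟨by simp, Fin.append (fun i => α (Fin.castAdd (n + 1) i)) β,
        ⟨by simpa using hα.1, by simpa using hβ⟩, fun i hi => ?_, ?_⟩
      · have hi' : i.1 ≤ m := by simpa [Fin.le_def] using hi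
        have : i = Fin.castAdd (n + 1) (⟨i.1, by omega⟩ : Fin (m + 1)) := rfl
        rw [this, Fin.append_left]
      · exact (Fin.append_right _ β ⟨0, h⟩).symm
  have h3 : ∀ α ∈ R, ∀ t : Fin n, C.succ R α (Fin.natAdd (m + 1) t.castSucc) =
      C.succ T (fun i => α (Fin.natAdd (m + 1) i)) t.castSucc := by
    intro α hα t
    ext A
    have ht := t.isLt
    constructor
    · rintro (⟨h, β, hβ, hag, rfl⟩ | ⟨h, -⟩)
      · refine Or.inl ⟨by simp, _, hβ.2, fun i hi => hag _ ?_, rfl⟩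
        simpa [Fin.le_def] using hi
      · simp at h; omega
    · rintro (⟨h, β, hβ, hag, rfl⟩ | ⟨h, -⟩)
      · refine Or.inl ⟨by simp; omega, Fin.append (fun i => α (Fin.castAdd (n + 1) i)) β,
          ⟨by simpa using hα.1, by simpa using hβ⟩, fun i hi => ?_, ?_⟩
        · induction i using Fin.addCases with
          | left i => rw [Fin.append_left]
          | right i =>
            rw [Fin.append_right]
            exact hag _ (by simpa [Fin.le_def] using hi)
        · exact (Fin.append_right _ β ⟨_, h⟩).symm
      · simp at h; omega
  have h4 : ∀ α, C.succ R α (Fin.natAdd (m + 1) (Fin.last n)) = C.initial S := by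
    intro α
    rw [← hin]
    ext A
    constructor
    · rintro (⟨h, -⟩ | ⟨-, h⟩)
      · simp at h; omega
      · exact h
    · intro h
      exact Or.inr ⟨by simp; omega, h⟩
  have hlast : ∀ (k : ℕ) (V : Set (Fin (k + 1) → C.sets)) (α), C.succ V α (Fin.last k) =
      C.initial V := by
    intro k V α
    ext A
    simp [succ]
  have hRsp : C.IsSpanning R := by
    refine ⟨by rw [hin]; exact hS.1, fun α hα t ht => ?_⟩
    induction t using Fin.addCases with
    | left t =>
      induction t using Fin.lastCases with
      | last => rw [h2 α hα]; exact (C.invariant _).trans hT.1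
      | cast t => rw [h1 α hα]; exact hS.2 _ hα.1 _ (by simp)
    | right t =>
      induction t using Fin.lastCases with
      | last => simp at ht; omega
      | cast t => rw [h3 α hα]; exact hT.2 _ hα.2 _ (by simp)
  have hle : C.rInv (m + 1 + (n + 1)) ≤ C.expansion R := Nat.sInf_le ⟨R, hRsp, rfl⟩
  refine hle.trans ?_
  rw [hN, hM]
  have : Nonempty R := (hRsp.nonempty hQ).to_subtype
  refine ciSup_le fun ⟨α, hα⟩ => ?_
  have e1 := C.le_expansion S _ hα.1
  have e2 := C.le_expansion T _ hα.2
  rw [Fin.prod_univ_castSucc, hlast] at e1 e2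
  rw [Fin.prod_univ_add, Fin.prod_univ_castSucc, Fin.prod_univ_castSucc]
  simp only [h1 α hα, h2 α hα, h3 α hα, h4]
  refine le_trans (le_of_eq ?_) (Nat.mul_le_mul e1 e2)
  ring

/-- The limit in the definition of the entropy exists. -/
theorem tendsto_entropy (hQ : Q.Nonempty) :
    Tendsto (fun τ : ℕ => (1 / (τ : ℝ)) * Real.logb 2 (C.rInv τ)) atTop (𝓝 C.entropy) := by
  have h0 : C.rInv 0 = 0 := by
    have : {N | ∃ S : Set (Fin 0 → C.sets), C.IsSpanning S ∧ N = C.expansion S} = ∅ := by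
      ext N
      simp only [Set.mem_ofPred_eq, Set.mem_empty_iff_false, iff_false]
      rintro ⟨S, hS, -⟩
      obtain ⟨x, hx⟩ := hQ
      obtain ⟨A, ⟨β, -, h, -⟩, -⟩ := Set.mem_iUnion₂.1 (hS.1 hx)
      exact absurd h (lt_irrefl 0)
    rw [rInv, this, Nat.sInf_empty]
  have hsub : Subadditive fun τ : ℕ => Real.logb 2 (C.rInv τ) := by
    rintro (_ | m) (_ | n)
    · simp [h0]
    · simp [h0]
    · simp [h0]
    · have hm : (0 : ℝ) < C.rInv (m + 1) := by exact_mod_cast C.rInv_pos hQ (Nat.succ_pos m)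
      have hn : (0 : ℝ) < C.rInv (n + 1) := by exact_mod_cast C.rInv_pos hQ (Nat.succ_pos n)
      have hmn : (0 : ℝ) < C.rInv (m + 1 + (n + 1)) := by
        exact_mod_cast C.rInv_pos hQ (by omega)
      rw [← Real.logb_mul hm.ne' hn.ne']
      exact Real.logb_le_logb_of_le one_lt_two hmn (by exact_mod_cast C.rInv_add_le hQ m n)
  have hlog : ∀ τ, 0 ≤ Real.logb 2 (C.rInv τ) := by
    rintro (_ | m)
    · simp [h0]
    · exact Real.logb_nonneg one_lt_two (by exact_mod_cast C.rInv_pos hQ (Nat.succ_pos m))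
  have hbdd : BddBelow (Set.range fun τ : ℕ => Real.logb 2 (C.rInv τ) / τ) :=
    ⟨0, by rintro _ ⟨τ, rfl⟩; exact div_nonneg (hlog τ) τ.cast_nonneg⟩
  refine tendsto_nhds_limUnder ⟨hsub.lim, ?_⟩
  simpa [div_eq_inv_mul] using hsub.tendsto_lim hbdd

end InvariantCover

/-- The invariance feedback entropy of a system and `Q`; it is `⊤` if there is no invariant
cover. -/
noncomputable def ControlSystem.hInv {X U : Type*} (sys : ControlSystem X U) (Q : Set X) : EReal :=
  ⨅ C : InvariantCover sys Q, (C.entropy : EReal)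

/-- A coder-controller `(S, γ, δ)` with a finite coding alphabet `S`, a coder function
`γ : ⋃ t, X^[0;t] → S` and a controller function `δ : ⋃ t, S^[0;t] → U`. -/
structure CoderController (X : Type u) (U : Type v) where
  S : Type w
  finite : Finite S
  γ : (t : ℕ) → (Fin (t + 1) → X) → S
  δ : (t : ℕ) → (Fin (t + 1) → S) → U

namespace CoderController

variable {X U : Type*} (H : CoderController X U)

/-- The map `Γ_t : X^[0;t] → S^[0;t]`. -/
def symbols {t : ℕ} (ξ : Fin (t + 1) → X) : Fin (t + 1) → H.S :=
  fun t' => H.γ t' (restrict ξ (t' + 1) t'.isLt)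

/-- The set `Z(ζ)` of possible successor symbols of `ζ ∈ S^[0;t)` in the closed loop, with
`Z(∅) = S`. -/
def post (sys : ControlSystem X U) : (t : ℕ) → (Fin t → H.S) → Set H.S
  | 0, _ => Set.univ
  | t + 1, ζ => {s | ∃ p ∈ sys.behavior,
      Fin.snoc (α := fun _ => H.S) ζ s = H.symbols (fun i : Fin (t + 2) => p.1 i) ∧
      ∀ t' : Fin (t + 1), p.2 t' = H.δ t' (restrict ζ (t' + 1) t'.isLt)}

/-- The set `𝒵_τ` of symbol sequences of length `τ` possible in the closed loop. -/
def sequences (sys : ControlSystem X U) (τ : ℕ) : Set (Fin τ → H.S) :=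
  {ζ | (∀ h : 0 < τ, ζ ⟨0, h⟩ ∈ Set.range (H.γ 0)) ∧
    ∀ t : Fin τ, 0 < t.1 → ζ t ∈ H.post sys t (restrict ζ t t.isLt.le)}

/-- The transmission data rate `R(H)`. The set `𝒵_τ` is finite, so for nonempty `𝒵_τ` the
supremum is a maximum. -/
noncomputable def rate (sys : ControlSystem X U) : EReal :=
  limsup (fun τ : ℕ =>
    ((⨆ ζ : H.sequences sys τ, (1 / (τ : ℝ)) *
      ∑ t : Fin τ, Real.logb 2 ((H.post sys t (restrict ζ.1 t t.isLt.le)).ncard : ℝ) : ℝ) :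
        EReal)) atTop

/-- `H` is `Q`-admissible: every closed-loop trajectory that starts in `Q` stays in `Q`. -/
def IsAdmissible (sys : ControlSystem X U) (Q : Set X) : Prop :=
  ∀ p ∈ sys.behavior, p.1 0 ∈ Q →
    (∀ t : ℕ, p.2 t = H.δ t (H.symbols (fun i : Fin (t + 1) => p.1 i))) →
    ∀ t : ℕ, p.1 t ∈ Q

end CoderController

/-! ### Bounding cover entropy by a potential -/

namespace InvariantCover

/-! Both inequalities cut time into blocks of a fixed length `m + 1` and restart at each block
boundary.

From coder to cover (`hInv_le_rate`): if `c` exceeds the rate, some block length makes the average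
log-cost of every possible symbol word less than `c`. The states reachable under a word of length at
most `m + 1` form a cover element, steered by the controller's input for that word. A full word is
followed by a one-symbol word, which is legitimate because admissibility keeps the state in `Q`.
Different words may give the same set, yet a cover assigns one input per set, so costs cannot simply
be summed along words. A potential on words, minus the accumulated excess of cost over `c`, turns
the block bound into a one-step inequality that survives the choice of a representative word; summed
along a path it telescopes (`exists_entropy_le_of_potential`).

From cover to coder (`iInf_rate_le_entropy`): the coder follows an optimal spanning set, restarting
after `m + 1` steps. Past symbols determine the current successor set, so the next symbol has at
most `#P` values, and each block costs at most the logarithm of the expansion number. -/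

theorem entropy_le_of_logb_rInv_le {X U : Type*} {sys : ControlSystem X U} {Q : Set X}
    (C : InvariantCover sys Q) (hQ : Q.Nonempty) {c K : ℝ}
    (h : ∀ n : ℕ, Real.logb 2 (C.rInv (n + 1)) ≤ c * ((n + 1 : ℕ) : ℝ) + K) : C.entropy ≤ c := by
  have hlim : Tendsto (fun τ : ℕ => c + K / (τ : ℝ)) atTop (𝓝 c) := by
    simpa using (tendsto_const_div_atTop_nhds_zero_nat K).const_add c
  refine le_of_tendsto_of_tendsto (C.tendsto_entropy hQ) hlim ?_
  filter_upwards [eventually_gt_atTop 0] with τ hτ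
  obtain ⟨n, rfl⟩ := Nat.exists_eq_succ_of_ne_zero hτ.ne'
  have hpos : (0 : ℝ) < ((n + 1 : ℕ) : ℝ) := by positivity
  rw [one_div_mul_eq_div, div_le_iff₀ hpos, add_mul, div_mul_cancel₀ _ hpos.ne']
  exact h n

/-- A finite family of subsets of `Q` with inputs, successor sets and a potential that accounts for
the logarithmic number of successors yields an invariant cover of small entropy. -/
theorem exists_entropy_le_of_potential {X U ι : Type*} [Finite ι] {sys : ControlSystem X U}
    {Q : Set X} (hQ : Q.Nonempty) (A : ι → Set X) (g : ι → U) (N : ι → Set ι) (φ : ι → ℝ) (c : ℝ)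
    (hA : ∀ i, (A i).Nonempty) (hAQ : ∀ i, A i ⊆ Q) (hcov : Q ⊆ ⋃ i, A i)
    (hN : ∀ i, ∀ x ∈ A i, sys.F x (g i) ⊆ ⋃ j ∈ N i, A j)
    (hφ : ∀ i, ∀ j ∈ N i, Real.logb 2 ((N i).ncard : ℝ) - c ≤ φ i - φ j) :
    ∃ C : InvariantCover sys Q, C.entropy ≤ c := by
  -- Among the indices with the same set, one of least potential is kept: replacing a successor `j`
  -- by its representative can only lower `φ j`, so the inequality `hφ` persists.
  have hrep : ∀ s : Set.range A, ∃ i, A i = s.1 ∧ ∀ j, A j = s.1 → φ i ≤ φ j := by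
    rintro ⟨_, i, rfl⟩
    obtain ⟨k, hk, hmin⟩ := Set.exists_min_image {j | A j = A i} φ (Set.toFinite _) ⟨i, rfl⟩
    exact ⟨k, hk, hmin⟩
  choose rep hrepA hrepmin using hrep
  let C : InvariantCover sys Q :=
    { sets := Set.range A
      G := fun s => g (rep s)
      finite := Set.finite_range A
      subset := by rintro _ ⟨i, rfl⟩; exact hAQ i
      covers := by rwa [Set.sUnion_range]
      invariant := by
        intro s
        refine Set.iUnion₂_subset fun x hx => (hN (rep s) x (by rwa [hrepA])).trans ?_
        exact Set.iUnion₂_subset fun j _ => hAQ j }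
  have : Finite C.sets := C.finite
  let B : ι → C.sets := fun j => ⟨A j, j, rfl⟩
  let next : C.sets → Set C.sets := fun s => B '' N (rep s)
  have hnext_cov : ∀ s : C.sets, ∀ x ∈ s.1, sys.F x (C.G s) ⊆ ⋃ s' ∈ next s, s'.1 := by
    intro s x hx y hy
    obtain ⟨j, hj, hyj⟩ := Set.mem_iUnion₂.1 (hN (rep s) x (by rwa [hrepA]) hy)
    exact Set.mem_iUnion₂.2 ⟨B j, ⟨j, hj, rfl⟩, hyj⟩
  have hnext_ne : ∀ s, (next s).Nonempty := by
    intro s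
    obtain ⟨x, hx⟩ := hA (rep s)
    rw [hrepA] at hx
    obtain ⟨y, hy⟩ := sys.strict x (C.G s)
    obtain ⟨s', hs', -⟩ := Set.mem_iUnion₂.1 (hnext_cov s x hx hy)
    exact ⟨s', hs'⟩
  have hstep : ∀ s, ∀ s' ∈ next s,
      Real.logb 2 ((next s).ncard : ℝ) ≤ c + φ (rep s) - φ (rep s') := by
    rintro s _ ⟨j, hj, rfl⟩
    have h1 := hφ (rep s) j hj
    have h2 : φ (rep (B j)) ≤ φ j := hrepmin (B j) j rfl
    have h3 : Real.logb 2 ((next s).ncard : ℝ) ≤ Real.logb 2 ((N (rep s)).ncard : ℝ) := by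
      refine Real.logb_le_logb_of_le one_lt_two ?_ ?_
      · exact_mod_cast (Set.ncard_pos (Set.toFinite _)).2 (hnext_ne s)
      · exact_mod_cast Set.ncard_image_le (Set.toFinite _)
    linarith
  choose f hf using hnext_ne
  -- Every partial path extends to full length, so the successor sets of `S n` are exactly the sets
  -- `next`.
  let path : C.sets → ℕ → C.sets := fun s k => f^[k] s
  have hpath : ∀ s k, path s (k + 1) ∈ next (path s k) := by
    intro s k
    simp only [path, Function.iterate_succ_apply']
    exact hf _
  let S : (n : ℕ) → Set (Fin (n + 1) → C.sets) := fun n =>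
    {α | ∀ t : Fin n, α t.succ ∈ next (α t.castSucc)}
  have hinit : ∀ n, C.initial (S n) = Set.univ := by
    intro n
    refine Set.eq_univ_of_forall fun s => ⟨fun i => path s i, fun t => ?_, Nat.succ_pos n, rfl⟩
    exact hpath s t
  have hsucc : ∀ n, ∀ α ∈ S n, ∀ t : Fin n, C.succ (S n) α t.castSucc = next (α t.castSucc) := by
    intro n α hα t
    ext s
    constructor
    · rintro (⟨h, β, hβ, hag, rfl⟩ | ⟨h, -⟩)
      · rw [← hag _ le_rfl]
        exact hβ t
      · have := t.isLt
        simp at h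
        omega
    · intro hs
      refine Or.inl ⟨by simp, fun i => if i.1 ≤ t.1 then α i else path s (i.1 - (t.1 + 1)),
        fun k => ?_, fun i hi => ?_, ?_⟩
      · rcases lt_trichotomy k.1 t.1 with hk | hk | hk
        · have h1 : k.1 + 1 ≤ t.1 := hk
          simpa [h1, hk.le] using hα k
        · obtain rfl : k = t := Fin.ext hk
          simpa [path] using hs
        · have h1 : ¬ k.1 + 1 ≤ t.1 := by omega
          have h2 : ¬ k.1 ≤ t.1 := by omega
          have h3 : k.1 + 1 - (t.1 + 1) = k.1 - (t.1 + 1) + 1 := by omega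
          simpa [h1, h2, h3, -Nat.reduceSubDiff] using
            hpath s (k.1 - (t.1 + 1))
      · have : i.1 ≤ t.1 := by simpa [Fin.le_def] using hi
        simp [this]
      · simp [path]
  have hlast : ∀ n α, C.succ (S n) α (Fin.last n) = Set.univ := by
    intro n α
    rw [← hinit n]
    ext s
    simp [succ]
  have hspan : ∀ n, C.IsSpanning (S n) := by
    intro n
    refine ⟨fun x hx => ?_, fun α hα t ht => ?_⟩
    · obtain ⟨s, hs, hxs⟩ := C.covers hx
      rw [hinit]
      exact Set.mem_iUnion₂.2 ⟨⟨s, hs⟩, trivial, hxs⟩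
    · obtain ⟨t, rfl⟩ : ∃ k : Fin n, t = k.castSucc := ⟨⟨t.1, by omega⟩, rfl⟩
      rw [hsucc n α hα t]
      exact Set.iUnion₂_subset fun x hx => hnext_cov _ x hx
  obtain ⟨M, hM⟩ := (Set.finite_range fun s : C.sets => |φ (rep s)|).bddAbove
  replace hM : ∀ s, |φ (rep s)| ≤ M := fun s => hM ⟨s, rfl⟩
  -- The telescoped potential costs at most `2 * M`; `|c|` pays for having `n` transitions instead
  -- of `n + 1`; the last factor of the product is the size of the whole cover.
  refine ⟨C, C.entropy_le_of_logb_rInv_le hQ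
    (K := 2 * M + |c| + Real.logb 2 ((Set.univ : Set C.sets).ncard : ℝ)) fun n => ?_⟩
  have : Nonempty (S n) := ((hspan n).nonempty hQ).to_subtype
  obtain ⟨⟨α, hα⟩, hαe⟩ := exists_eq_ciSup_of_finite
    (f := fun α : S n => ∏ t : Fin (n + 1), (C.succ (S n) α.1 t).ncard)
  have hle : C.rInv (n + 1) ≤ C.expansion (S n) := Nat.sInf_le ⟨S n, hspan n, rfl⟩
  replace hle : C.rInv (n + 1) ≤ ∏ t : Fin (n + 1), (C.succ (S n) α t).ncard := hle.trans hαe.ge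
  have hpos : ∀ s, ((next s).ncard : ℝ) ≠ 0 := fun s =>
    Nat.cast_ne_zero.2 ((Set.ncard_pos (Set.toFinite _)).2 ⟨f s, hf s⟩).ne'
  have huniv : ((Set.univ : Set C.sets).ncard : ℝ) ≠ 0 :=
    Nat.cast_ne_zero.2 ((Set.ncard_pos (Set.toFinite _)).2 ⟨α 0, Set.mem_univ _⟩).ne'
  have hlog : Real.logb 2 (C.rInv (n + 1)) ≤
      ∑ t : Fin n, Real.logb 2 ((next (α t.castSucc)).ncard : ℝ) +
        Real.logb 2 ((Set.univ : Set C.sets).ncard : ℝ) := by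
    rw [← Real.logb_prod _ (fun t : Fin n => ((next (α t.castSucc)).ncard : ℝ)) fun _ _ => hpos _,
      ← Real.logb_mul (Finset.prod_ne_zero_iff.2 fun _ _ => hpos _) huniv]
    refine Real.logb_le_logb_of_le one_lt_two ?_ ?_
    · exact_mod_cast C.rInv_pos hQ (Nat.succ_pos n)
    · rw [Fin.prod_univ_castSucc, hlast] at hle
      simp only [hsucc n α hα] at hle
      exact_mod_cast hle
  have hsum : ∑ t : Fin n, Real.logb 2 ((next (α t.castSucc)).ncard : ℝ) ≤
      ∑ t : Fin n, (c + φ (rep (α t.castSucc)) - φ (rep (α t.succ))) :=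
    Finset.sum_le_sum fun t _ => hstep _ _ (hα t)
  have htel := (Fin.sum_univ_castSucc fun t => φ (rep (α t))).symm.trans
    (Fin.sum_univ_succ fun t => φ (rep (α t)))
  simp only [Finset.sum_sub_distrib, Finset.sum_add_distrib, Finset.sum_const, Finset.card_univ,
    Fintype.card_fin, nsmul_eq_mul] at hsum
  have h0 := abs_le.1 (hM (α 0))
  have h1 := abs_le.1 (hM (α (Fin.last n)))
  have hc := neg_abs_le c
  push_cast
  linarith

end InvariantCover

/-! ### From an admissible coder-controller to an invariant cover -/

namespace CoderController

variable {X : Type u} {U : Type v} (H : CoderController.{w} X U)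

/-- The state sequences of the closed loop that start in `Q`. -/
def closedLoop (sys : ControlSystem X U) (Q : Set X) : Set (ℕ → X) :=
  {ξ | ξ 0 ∈ Q ∧
    ∀ t, ξ (t + 1) ∈ sys.F (ξ t) (H.δ t (H.symbols fun i : Fin (t + 1) => ξ i))}

/-- The last states of closed-loop state sequences with symbol sequence `ζ`. -/
def reach (sys : ControlSystem X U) (Q : Set X) {t : ℕ} (ζ : Fin (t + 1) → H.S) : Set X :=
  {x | ∃ ξ ∈ H.closedLoop sys Q, H.symbols (fun i : Fin (t + 1) => ξ i) = ζ ∧ ξ t = x}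

variable {H} {sys : ControlSystem X U} {Q : Set X}

theorem IsAdmissible.mem_of_closedLoop (hH : H.IsAdmissible sys Q) {ξ : ℕ → X}
    (hξ : ξ ∈ H.closedLoop sys Q) (t : ℕ) : ξ t ∈ Q :=
  hH (ξ, fun t => H.δ t (H.symbols fun i : Fin (t + 1) => ξ i)) hξ.2 hξ.1 (fun _ => rfl) t

/-- The sequence generated by a rule that determines each entry from the preceding ones. -/
def iterateHistory {X : Type*} (x₀ : X) (g : (t : ℕ) → (Fin (t + 1) → X) → X) : ℕ → X
  | 0 => x₀
  | t + 1 => g t fun i => iterateHistory x₀ g i.1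
termination_by t => t
decreasing_by exact i.2

variable (H sys) in
theorem exists_closedLoop_zero {x : X} (hx : x ∈ Q) : ∃ ξ ∈ H.closedLoop sys Q, ξ 0 = x := by
  choose f hf using sys.strict
  let ξ := iterateHistory x fun t h => f (h (Fin.last t)) (H.δ t (H.symbols h))
  have h0 : ξ 0 = x := by simp only [ξ]; rw [iterateHistory]
  refine ⟨ξ, ⟨h0 ▸ hx, fun t => ?_⟩, h0⟩
  have : ξ (t + 1) = f (ξ t) (H.δ t (H.symbols fun i : Fin (t + 1) => ξ i)) := by
    simp only [ξ]; rw [iterateHistory]; rfl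
  rw [this]
  exact hf _ _

/-- Inputs depend only on the past, so changing the state after time `t` leaves the earlier inputs
intact; strictness of `F` supplies a continuation. -/
theorem exists_closedLoop_extend {ξ : ℕ → X} (hξ : ξ ∈ H.closedLoop sys Q) (t : ℕ) {y : X}
    (hy : y ∈ sys.F (ξ t) (H.δ t (H.symbols fun i : Fin (t + 1) => ξ i))) :
    ∃ ξ' ∈ H.closedLoop sys Q, (∀ i ≤ t, ξ' i = ξ i) ∧ ξ' (t + 1) = y := by
  choose f hf using sys.strict
  let ξ' := iterateHistory (ξ 0) fun k h =>
    if k < t then ξ (k + 1) else if k = t then y else f (h (Fin.last k)) (H.δ k (H.symbols h))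
  have h0 : ξ' 0 = ξ 0 := by simp only [ξ']; rw [iterateHistory]
  have hs : ∀ k, ξ' (k + 1) = if k < t then ξ (k + 1) else if k = t then y else
      f (ξ' k) (H.δ k (H.symbols fun i : Fin (k + 1) => ξ' i)) := by
    intro k
    simp only [ξ']; rw [iterateHistory]; rfl
  have hag : ∀ i ≤ t, ξ' i = ξ i := by
    rintro (_ | k) hk
    · exact h0
    · rw [hs, if_pos (Nat.lt_of_succ_le hk)]
  have hpre : ∀ k ≤ t, (fun i : Fin (k + 1) => ξ' i) = fun i : Fin (k + 1) => ξ i := fun k hk =>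
    funext fun i => hag _ (by have := i.isLt; omega)
  have hy' : ξ' (t + 1) = y := by simp [hs]
  refine ⟨ξ', ⟨h0 ▸ hξ.1, fun k => ?_⟩, hag, hy'⟩
  rcases lt_trichotomy k t with hk | rfl | hk
  · rw [hpre k hk.le, hag k hk.le, hag (k + 1) hk]
    exact hξ.2 k
  · rw [hpre k le_rfl, hag k le_rfl, hy']
    exact hy
  · rw [hs, if_neg hk.not_gt, if_neg hk.ne']
    exact hf _ _

theorem snoc_mem_post {ξ : ℕ → X} (hξ : ξ ∈ H.closedLoop sys Q) {t : ℕ} :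
    H.symbols (fun i : Fin (t + 2) => ξ i) (Fin.last (t + 1)) ∈
      H.post sys (t + 1) (H.symbols fun i : Fin (t + 1) => ξ i) := by
  refine ⟨(ξ, fun t => H.δ t (H.symbols fun i : Fin (t + 1) => ξ i)), hξ.2, ?_, fun _ => rfl⟩
  exact Fin.snoc_init_self (α := fun _ => H.S) (H.symbols fun i : Fin (t + 2) => ξ i)

theorem symbols_mem_sequences {ξ : ℕ → X} (hξ : ξ ∈ H.closedLoop sys Q) (t : ℕ) :
    (H.symbols fun i : Fin (t + 1) => ξ i) ∈ H.sequences sys (t + 1) := by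
  refine ⟨fun h => ⟨_, rfl⟩, fun ⟨k, hk⟩ hk0 => ?_⟩
  obtain ⟨k, rfl⟩ := Nat.exists_eq_succ_of_ne_zero hk0.ne'
  exact snoc_mem_post hξ

theorem hInv_le_rate (hQ : Q.Nonempty) (hH : H.IsAdmissible sys Q) :
    sys.hInv Q ≤ H.rate sys := by
  refine EReal.le_of_forall_lt_iff_le.1 fun c hc => ?_
  have : Finite H.S := H.finite
  obtain ⟨T, hT, hT0⟩ :=
    ((eventually_lt_of_limsup_lt hc).and (eventually_gt_atTop 0)).exists
  obtain ⟨m, rfl⟩ := Nat.exists_eq_succ_of_ne_zero hT0.ne'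
  let cost : (t : ℕ) → (Fin t → H.S) → ℝ := fun t ζ => Real.logb 2 ((H.post sys t ζ).ncard : ℝ)
  have hcost : ∀ ζ ∈ H.sequences sys (m + 1),
      ∑ t : Fin (m + 1), (cost t (restrict ζ t t.isLt.le) - c) ≤ 0 := by
    intro ζ hζ
    have h1 := le_ciSup (f := fun ζ : H.sequences sys (m + 1) => (1 / ((m + 1 : ℕ) : ℝ)) *
      ∑ t : Fin (m + 1), Real.logb 2 ((H.post sys t (restrict ζ.1 t t.isLt.le)).ncard : ℝ))
      (Set.finite_range _).bddAbove ⟨ζ, hζ⟩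
    have h2 := h1.trans (EReal.coe_lt_coe_iff.1 hT).le
    have hpos : (0 : ℝ) < ((m + 1 : ℕ) : ℝ) := by positivity
    rw [one_div_mul_eq_div, div_le_iff₀ hpos] at h2
    rw [Finset.sum_sub_distrib]
    simpa [mul_comm] using h2
  -- Nonemptiness of the reach set guarantees that the word occurs in the closed loop, so `hcost`
  -- applies to it at full length.
  let I : Type w := {ζ : Σ t : Fin (m + 1), (Fin (t.1 + 1) → H.S) // (H.reach sys Q ζ.2).Nonempty}
  -- The term `t = 0` charges `log #S`, which is what a restart costs.
  let φ : I → ℝ := fun i =>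
    -∑ t : Fin (i.1.1.1 + 1), (cost t (restrict i.1.2 t t.isLt.le) - c)
  let N : I → Set I := fun i =>
    {j | (∃ h : i.1.1.1 + 1 < m + 1, ∃ s ∈ H.post sys (i.1.1.1 + 1) i.1.2,
        j.1 = ⟨⟨i.1.1.1 + 1, h⟩, Fin.snoc (α := fun _ => H.S) i.1.2 s⟩) ∨
      (i.1.1.1 = m ∧ ∃ s : H.S, j.1 = ⟨0, fun _ => s⟩)}
  obtain ⟨C, hC⟩ := InvariantCover.exists_entropy_le_of_potential (sys := sys) hQ
    (fun i : I => H.reach sys Q i.1.2) (fun i => H.δ _ i.1.2) N φ c (fun i => i.2)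
    (by rintro i _ ⟨ξ, hξ, -, rfl⟩; exact hH.mem_of_closedLoop hξ _)
    (by
      intro x hx
      obtain ⟨ξ, hξ, rfl⟩ := H.exists_closedLoop_zero sys hx
      have hmem : ξ 0 ∈ H.reach sys Q (H.symbols fun i : Fin 1 => ξ i) := ⟨ξ, hξ, rfl, rfl⟩
      exact Set.mem_iUnion.2 ⟨(⟨⟨0, _⟩, ⟨_, hmem⟩⟩ : I), hmem⟩)
    (by
      rintro ⟨⟨⟨t, ht⟩, ζ⟩, hne⟩ _ ⟨ξ, hξ, hζ, rfl⟩ y hy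
      change Fin (t + 1) → H.S at ζ
      change H.symbols (fun i : Fin (t + 1) => ξ i) = ζ at hζ
      change y ∈ sys.F (ξ t) (H.δ t ζ) at hy
      subst hζ
      obtain ⟨ξ', hξ', hag, rfl⟩ := exists_closedLoop_extend hξ t hy
      have hpre : (fun i : Fin (t + 1) => ξ i) = fun i : Fin (t + 1) => ξ' i :=
        funext fun i => (hag _ (by have := i.isLt; omega)).symm
      by_cases h : t + 1 < m + 1
      · have hmem : ξ' (t + 1) ∈ H.reach sys Q (H.symbols fun i : Fin (t + 2) => ξ' i) :=
          ⟨ξ', hξ', rfl, rfl⟩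
        refine Set.mem_iUnion₂.2 ⟨(⟨⟨⟨t + 1, h⟩, _⟩, ⟨_, hmem⟩⟩ : I),
          Or.inl ⟨h, H.symbols (fun i : Fin (t + 2) => ξ' i) (Fin.last (t + 1)), ?_, ?_⟩, hmem⟩
        · change _ ∈ H.post sys (t + 1) (H.symbols fun i : Fin (t + 1) => ξ i)
          rw [hpre]
          exact snoc_mem_post hξ'
        · change (⟨⟨t + 1, h⟩, H.symbols fun i : Fin (t + 2) => ξ' i⟩ :
            Σ t : Fin (m + 1), (Fin (t.1 + 1) → H.S)) = ⟨⟨t + 1, h⟩, Fin.snoc (α := fun _ => H.S)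
              (H.symbols fun i : Fin (t + 1) => ξ i) _⟩
          rw [hpre]
          exact congrArg (Sigma.mk _) (Fin.snoc_init_self (α := fun _ => H.S)
            (H.symbols fun i : Fin (t + 2) => ξ' i)).symm
      -- At the end of a block the next state is still in `Q` and is taken as the initial state of a
      -- fresh closed loop.
      · have hyQ := hH.mem_of_closedLoop hξ' (t + 1)
        obtain ⟨ξ₁, hξ₁, h1⟩ := H.exists_closedLoop_zero sys hyQ
        have hmem : ξ' (t + 1) ∈ H.reach sys Q (H.symbols fun i : Fin 1 => ξ₁ i) :=
          ⟨ξ₁, hξ₁, rfl, h1⟩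
        refine Set.mem_iUnion₂.2 ⟨(⟨⟨0, _⟩, ⟨_, hmem⟩⟩ : I),
          Or.inr ⟨by change t = m; omega, H.symbols (fun i : Fin 1 => ξ₁ i) 0, ?_⟩, hmem⟩
        refine congrArg (Sigma.mk _) (funext fun i => ?_)
        exact congrArg (H.symbols fun i : Fin 1 => ξ₁ i) (Subsingleton.elim (α := Fin 1) i 0))
    (by
      rintro ⟨⟨⟨t, ht⟩, ζ⟩, hne⟩ j hj
      change Fin (t + 1) → H.S at ζ
      have hcard : ∀ (P : Set H.S) (g : H.S → Σ t : Fin (m + 1), (Fin (t.1 + 1) → H.S)),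
          (∀ j ∈ N ⟨⟨⟨t, ht⟩, ζ⟩, hne⟩, ∃ s ∈ P, j.1 = g s) →
          Real.logb 2 ((N ⟨⟨⟨t, ht⟩, ζ⟩, hne⟩).ncard : ℝ) ≤ Real.logb 2 (P.ncard : ℝ) := by
        intro P g hg
        refine Real.logb_le_logb_of_le one_lt_two ?_ ?_
        · exact_mod_cast (Set.ncard_pos (Set.toFinite _)).2 ⟨j, hj⟩
        · rw [Nat.cast_le, ← Set.ncard_image_of_injective _ Subtype.val_injective]
          refine (Set.ncard_le_ncard (t := g '' P) ?_ (Set.toFinite _)).trans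
            (Set.ncard_image_le (Set.toFinite _))
          rintro _ ⟨k, hk, rfl⟩
          obtain ⟨s, hs, h⟩ := hg k hk
          exact ⟨s, hs, h.symm⟩
      obtain ⟨j, hjne⟩ := j
      by_cases h : t + 1 < m + 1
      · have hle := hcard (H.post sys (t + 1) ζ)
          (fun s => ⟨⟨t + 1, h⟩, Fin.snoc (α := fun _ => H.S) ζ s⟩) (by
            rintro k (⟨_, s, hs, hk⟩ | ⟨hk, -⟩)
            · exact ⟨s, hs, hk⟩
            · change t = m at hk
              omega)
        rcases hj with ⟨_, s, hs, hj⟩ | ⟨hk, -⟩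
        · dsimp only at hj
          subst hj
          have hφ : φ ⟨⟨⟨t + 1, h⟩, Fin.snoc (α := fun _ => H.S) ζ s⟩, hjne⟩ =
              φ ⟨⟨⟨t, ht⟩, ζ⟩, hne⟩ - (cost (t + 1) ζ - c) := by
            have hr : ∀ (k : ℕ) (hk : k ≤ t + 1),
                restrict (Fin.snoc (α := fun _ => H.S) ζ s) k (hk.trans (Nat.le_succ _)) =
                  restrict ζ k hk := by
              intro k hk
              funext i
              exact Fin.snoc_castSucc (α := fun _ => H.S) s ζ (Fin.castLE hk i)
            simp only [φ]
            rw [Fin.sum_univ_castSucc]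
            have h1 : restrict (Fin.snoc (α := fun _ => H.S) ζ s) (t + 1) (Nat.le_succ _) = ζ :=
              hr (t + 1) le_rfl
            have h2 : ∀ k : Fin (t + 1),
                restrict (Fin.snoc (α := fun _ => H.S) ζ s) k
                  (k.isLt.le.trans (Nat.le_succ _)) = restrict ζ k k.isLt.le :=
              fun k => hr k k.isLt.le
            simp only [Fin.val_last, Fin.val_castSucc, h1, h2]
            ring
          rw [hφ]
          simp only [cost]
          linarith
        · change t = m at hk
          omega
      -- On a restart `φ j = -(log #S - c)`, so `0 ≤ φ i` suffices; for a full word this is the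
      -- block bound `hcost`.
      · obtain rfl : t = m := by omega
        have hle := hcard Set.univ (fun s => ⟨0, fun _ => s⟩) (by
            rintro k (⟨hk, -⟩ | ⟨-, s, hk⟩)
            · exact absurd hk h
            · exact ⟨s, trivial, hk⟩)
        rcases hj with ⟨hk, -⟩ | ⟨-, s, hj⟩
        · exact absurd hk h
        · dsimp only at hj
          subst hj
          have h0 : φ ⟨⟨0, fun _ => s⟩, hjne⟩ =
              -(Real.logb 2 ((Set.univ : Set H.S).ncard : ℝ) - c) := by
            exact congrArg Neg.neg (Fin.sum_univ_one fun k : Fin 1 =>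
              cost k (restrict (fun _ : Fin 1 => s) k k.isLt.le) - c)
          have h1 : 0 ≤ φ ⟨⟨⟨t, ht⟩, ζ⟩, hne⟩ := by
            obtain ⟨_, ξ, hξ, hζ, -⟩ := hne
            refine neg_nonneg.2 (hcost ζ ?_)
            have hmem := symbols_mem_sequences hξ t
            rwa [show (H.symbols fun i : Fin (t + 1) => ξ i) = ζ from hζ] at hmem
          rw [h0]
          linarith)
  exact (iInf_le _ C).trans (EReal.coe_le_coe_iff.2 hC)

end CoderController

/-! ### From an invariant cover to a block coder -/

namespace InvariantCover

variable {X : Type u} {U : Type v} {sys : ControlSystem X U} {Q : Set X} (C : InvariantCover sys Q)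
  {m : ℕ}

theorem succ_congr (S : Set (Fin (m + 1) → C.sets)) {α β : Fin (m + 1) → C.sets}
    {t : Fin (m + 1)} (h : ∀ i ≤ t, α i = β i) : C.succ S α t = C.succ S β t := by
  ext A
  have : ∀ κ : Fin (m + 1) → C.sets, (∀ i ≤ t, κ i = α i) ↔ ∀ i ≤ t, κ i = β i := fun κ =>
    forall₂_congr fun i hi => by rw [h i hi]
  simp only [succ, this]

/-- The position of time `t` in its block of length `m + 1`. -/
def blockPos (m t : ℕ) : Fin (m + 1) := ⟨t % (m + 1), Nat.mod_lt _ (Nat.succ_pos m)⟩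

/-- The sequences that may follow `α` in the next step of the block coder: inside a block they
agree with `α` on the part of the block that has elapsed. -/
def Follows (S : Set (Fin (m + 1) → C.sets)) (t : ℕ) (α β : Fin (m + 1) → C.sets) : Prop :=
  β ∈ S ∧ (t % (m + 1) + 1 < m + 1 → ∀ i ≤ blockPos m t, β i = α i)

open Classical in
/-- The sequence of `S` that the block coder follows at time `t`, for the state sequence `ξ`. -/
noncomputable def codeState (S : Set (Fin (m + 1) → C.sets)) (α₀ : Fin (m + 1) → C.sets)
    (ξ : ℕ → X) : ℕ → Fin (m + 1) → C.sets
  | 0 => if h : ∃ β ∈ S, ξ 0 ∈ (β 0).1 then h.choose else α₀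
  | t + 1 =>
    if h : ∃ β, C.Follows S t (codeState S α₀ ξ t) β ∧ ξ (t + 1) ∈ (β (blockPos m (t + 1))).1
    then h.choose else codeState S α₀ ξ t

/-- The cover element that the block coder transmits at time `t`. -/
noncomputable def codeSymbol (S : Set (Fin (m + 1) → C.sets)) (α₀ : Fin (m + 1) → C.sets)
    (ξ : ℕ → X) (t : ℕ) : C.sets :=
  C.codeState S α₀ ξ t (blockPos m t)

variable {C} {S : Set (Fin (m + 1) → C.sets)} {α₀ : Fin (m + 1) → C.sets}

theorem codeState_congr {ξ ξ' : ℕ → X} {t : ℕ} (h : ∀ i ≤ t, ξ i = ξ' i) :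
    C.codeState S α₀ ξ t = C.codeState S α₀ ξ' t := by
  induction t with
  | zero => simp only [codeState]; rw [h 0 le_rfl]
  | succ t ih =>
    simp only [codeState]
    rw [h (t + 1) le_rfl, ih fun i hi => h i (hi.trans (Nat.le_succ t))]

theorem codeState_mem (hα₀ : α₀ ∈ S) (ξ : ℕ → X) (t : ℕ) : C.codeState S α₀ ξ t ∈ S := by
  induction t with
  | zero =>
    rw [codeState]
    split_ifs with h
    · exact h.choose_spec.1
    · exact hα₀
  | succ t ih =>
    rw [codeState]
    split_ifs with h
    · exact h.choose_spec.1.1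
    · exact ih

/-- No condition on `ξ` is needed: when no sequence fits, the retained one follows itself. This
matters because `post` admits trajectories starting outside `Q`. -/
theorem follows_codeState (hα₀ : α₀ ∈ S) (ξ : ℕ → X) (t : ℕ) :
    C.Follows S t (C.codeState S α₀ ξ t) (C.codeState S α₀ ξ (t + 1)) := by
  rw [codeState]
  split_ifs with h
  · exact h.choose_spec.1
  · exact ⟨codeState_mem hα₀ ξ t, fun _ _ _ => rfl⟩

theorem blockPos_of_lt {b j : ℕ} (hj : j < m + 1) : blockPos m (b * (m + 1) + j) = ⟨j, hj⟩ := by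
  ext
  simp only [blockPos]
  rw [Nat.mul_comm, Nat.mul_add_mod, Nat.mod_eq_of_lt hj]

theorem blockPos_succ_of_eq {t : ℕ} (h : t % (m + 1) + 1 = m + 1) : blockPos m (t + 1) = 0 := by
  ext
  have : (t + 1) % (m + 1) = (t % (m + 1) + 1) % (m + 1) := by simp
  simp only [blockPos, this, h, Nat.mod_self, Fin.val_zero]

theorem blockPos_succ_of_lt {t : ℕ} (h : t % (m + 1) + 1 < m + 1) :
    blockPos m (t + 1) = ⟨t % (m + 1) + 1, h⟩ := by
  ext
  have : (t + 1) % (m + 1) = (t % (m + 1) + 1) % (m + 1) := by simp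
  simp only [blockPos, this, Nat.mod_eq_of_lt h]

theorem Follows.mem_succ {t : ℕ} {α β : Fin (m + 1) → C.sets} (h : C.Follows S t α β) :
    β (blockPos m (t + 1)) ∈ C.succ S α (blockPos m t) := by
  rcases (Nat.succ_le_of_lt (Nat.mod_lt t (Nat.succ_pos m))).lt_or_eq with hlt | heq
  · rw [blockPos_succ_of_lt hlt]
    exact Or.inl ⟨hlt, β, h.1, h.2 hlt, rfl⟩
  · rw [blockPos_succ_of_eq heq]
    exact Or.inr ⟨heq, β, h.1, Nat.succ_pos m, rfl⟩

theorem codeSymbol_succ_mem (hα₀ : α₀ ∈ S) (ξ : ℕ → X) (t : ℕ) :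
    C.codeSymbol S α₀ ξ (t + 1) ∈ C.succ S (C.codeState S α₀ ξ t) (blockPos m t) :=
  (follows_codeState hα₀ ξ t).mem_succ

/-- Inside a block the followed sequence changes only at positions that have not been reached. -/
theorem codeState_block (hα₀ : α₀ ∈ S) (ξ : ℕ → X) (b : ℕ) {i j : ℕ} (hij : i ≤ j)
    (hj : j < m + 1) (k : Fin (m + 1)) (hk : k.1 ≤ i) :
    C.codeState S α₀ ξ (b * (m + 1) + j) k = C.codeState S α₀ ξ (b * (m + 1) + i) k := by
  induction j, hij using Nat.le_induction with
  | base => rfl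
  | succ j hij ih =>
    rw [← ih (by omega)]
    have hmod : (b * (m + 1) + j) % (m + 1) = j := by
      rw [Nat.mul_comm, Nat.mul_add_mod, Nat.mod_eq_of_lt (by omega)]
    refine (follows_codeState hα₀ ξ (b * (m + 1) + j)).2 (by omega) k ?_
    rw [Fin.le_def]
    simp only [blockPos, hmod]
    omega

theorem codeState_eq_codeSymbol (hα₀ : α₀ ∈ S) (ξ : ℕ → X) (t : ℕ) (k : Fin (m + 1))
    (hk : k ≤ blockPos m t) :
    C.codeState S α₀ ξ t k = C.codeSymbol S α₀ ξ (t / (m + 1) * (m + 1) + k) := by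
  have h := codeState_block (C := C) hα₀ ξ (t / (m + 1)) (i := k.1) (j := t % (m + 1)) hk
    (Nat.mod_lt _ (Nat.succ_pos m)) k le_rfl
  rw [Nat.div_add_mod'] at h
  rw [h, codeSymbol, blockPos_of_lt k.isLt]

/-- The symbols need not determine the whole followed sequence, but they determine its elapsed part
in the block, on which alone the successor set depends. -/
theorem succ_codeState_congr (hα₀ : α₀ ∈ S) {ξ ξ' : ℕ → X} {t : ℕ}
    (h : ∀ i ≤ t, C.codeSymbol S α₀ ξ i = C.codeSymbol S α₀ ξ' i) :
    C.succ S (C.codeState S α₀ ξ t) (blockPos m t) =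
      C.succ S (C.codeState S α₀ ξ' t) (blockPos m t) := by
  refine C.succ_congr S fun k hk => ?_
  rw [codeState_eq_codeSymbol hα₀ ξ t k hk, codeState_eq_codeSymbol hα₀ ξ' t k hk]
  refine h _ ?_
  have h1 : k.1 ≤ t % (m + 1) := hk
  have h2 := Nat.div_add_mod' t (m + 1)
  omega

theorem mem_codeSymbol_zero (hS : C.IsSpanning S) {ξ : ℕ → X} (h : ξ 0 ∈ Q) :
    ξ 0 ∈ (C.codeSymbol S α₀ ξ 0).1 := by
  have hex : ∃ β ∈ S, ξ 0 ∈ (β 0).1 := by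
    obtain ⟨_, ⟨β, hβ, _, rfl⟩, hx⟩ := Set.mem_iUnion₂.1 (hS.1 h)
    exact ⟨β, hβ, hx⟩
  have h0 : blockPos m 0 = 0 := by ext; simp [blockPos]
  rw [codeSymbol, codeState, dif_pos hex, h0]
  exact hex.choose_spec.2

/-- Within a block the spanning condition supplies the next element; at its end invariance returns
the state to `Q`, which the initial elements cover. -/
theorem mem_codeSymbol_succ (hS : C.IsSpanning S) (hα₀ : α₀ ∈ S) {ξ : ℕ → X} {t : ℕ}
    (h : ξ t ∈ (C.codeSymbol S α₀ ξ t).1)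
    (hF : ξ (t + 1) ∈ sys.F (ξ t) (C.G (C.codeSymbol S α₀ ξ t))) :
    ξ (t + 1) ∈ (C.codeSymbol S α₀ ξ (t + 1)).1 := by
  have hmem : ξ (t + 1) ∈ ⋃ x ∈ (C.codeSymbol S α₀ ξ t).1,
      sys.F x (C.G (C.codeSymbol S α₀ ξ t)) := Set.mem_iUnion₂.2 ⟨_, h, hF⟩
  have hex : ∃ β, C.Follows S t (C.codeState S α₀ ξ t) β ∧
      ξ (t + 1) ∈ (β (blockPos m (t + 1))).1 := by
    rcases (Nat.succ_le_of_lt (Nat.mod_lt t (Nat.succ_pos m))).lt_or_eq with hlt | heq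
    · obtain ⟨A, hA, hx⟩ := Set.mem_iUnion₂.1
        (hS.2 _ (codeState_mem hα₀ ξ t) (blockPos m t) hlt hmem)
      rcases hA with ⟨_, β, hβ, hag, rfl⟩ | ⟨hA, -⟩
      · exact ⟨β, ⟨hβ, fun _ => hag⟩, by rw [blockPos_succ_of_lt hlt]; exact hx⟩
      · exact absurd hA hlt.ne
    · obtain ⟨_, ⟨β, hβ, _, rfl⟩, hx⟩ := Set.mem_iUnion₂.1 (hS.1 (C.invariant _ hmem))
      exact ⟨β, ⟨hβ, fun hlt => absurd heq hlt.ne⟩, by rw [blockPos_succ_of_eq heq]; exact hx⟩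
  rw [codeSymbol, codeState, dif_pos hex]
  exact hex.choose_spec.2

theorem ncard_succ_codeState_pos (hα₀ : α₀ ∈ S) (ξ : ℕ → X) (t : ℕ) :
    0 < (C.succ S (C.codeState S α₀ ξ t) (blockPos m t)).ncard := by
  have : Finite C.sets := C.finite
  exact (Set.ncard_pos (Set.toFinite _)).2 ⟨_, codeSymbol_succ_mem hα₀ ξ t⟩

theorem sum_logb_succ_codeState_le (hα₀ : α₀ ∈ S) (ξ : ℕ → X) (b : ℕ) :
    ∑ t ∈ Finset.range (b * (m + 1)),
      Real.logb 2 ((C.succ S (C.codeState S α₀ ξ t) (blockPos m t)).ncard : ℝ) ≤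
      b * Real.logb 2 (C.expansion S) := by
  induction b with
  | zero => simp
  | succ b ih =>
    rw [Nat.succ_mul, Finset.sum_range_add, Nat.cast_succ, add_mul, one_mul]
    refine add_le_add ih ?_
    have hpos := fun t => (Nat.cast_pos (α := ℝ)).2 (ncard_succ_codeState_pos (C := C) hα₀ ξ t)
    rw [← Real.logb_prod _ _ fun t _ => (hpos _).ne']
    refine Real.logb_le_logb_of_le one_lt_two (Finset.prod_pos fun t _ => hpos _) ?_
    rw [← Nat.cast_prod, Nat.cast_le, Finset.prod_range]
    refine le_trans (le_of_eq ?_)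
      -- The sequence held at the end of the block agrees with every earlier one on its elapsed
      -- part, so the block's product is that of a single element of `S`.
      (C.le_expansion S (C.codeState S α₀ ξ (b * (m + 1) + m)) (codeState_mem hα₀ ξ _))
    refine Finset.prod_congr rfl fun j _ => ?_
    rw [blockPos_of_lt j.isLt]
    refine congrArg Set.ncard (C.succ_congr S fun k hk => ?_)
    exact (codeState_block hα₀ ξ b (Nat.le_of_lt_succ j.isLt) (Nat.lt_succ_self m) k hk).symm

variable (S α₀) in
/-- The coder-controller that transmits the cover elements `codeSymbol` with an alphabet `B`
identified with the cover by `e`. -/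
noncomputable def blockCoder {B : Type w} (e : C.sets ≃ B) : CoderController.{w} X U where
  S := B
  finite := have : Finite C.sets := C.finite; Finite.of_equiv _ e
  -- The history is padded with its last state; by causality (`codeState_congr`) the padding has no
  -- effect.
  γ t x := e (C.codeSymbol S α₀ (fun i => x ⟨min i t, by omega⟩) t)
  δ t ζ := C.G (e.symm (ζ (Fin.last t)))

theorem symbols_blockCoder {B : Type w} (e : C.sets ≃ B) (ξ : ℕ → X) (t : ℕ) (i : Fin (t + 1)) :
    (blockCoder S α₀ e).symbols (fun i : Fin (t + 1) => ξ i) i = e (C.codeSymbol S α₀ ξ i) := by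
  refine congrArg e (congrFun (codeState_congr fun k hk => ?_) _)
  exact congrArg ξ (min_eq_left hk)

theorem isAdmissible_blockCoder {B : Type w} (e : C.sets ≃ B) (hS : C.IsSpanning S)
    (hα₀ : α₀ ∈ S) : (blockCoder S α₀ e).IsAdmissible sys Q := by
  intro p hp h0 hδ t
  have hν : ∀ t, p.2 t = C.G (C.codeSymbol S α₀ p.1 t) := by
    intro t
    rw [hδ t]
    exact congrArg C.G (e.symm_apply_eq.2 (symbols_blockCoder e p.1 t (Fin.last t)))
  have hmem : ∀ t, p.1 t ∈ (C.codeSymbol S α₀ p.1 t).1 := by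
    intro t
    induction t with
    | zero => exact mem_codeSymbol_zero hS h0
    | succ t ih => exact mem_codeSymbol_succ hS hα₀ ih (hν t ▸ hp t)
  exact C.subset _ (C.codeSymbol S α₀ p.1 t).2 (hmem t)

/-- The trajectory witnessing the last symbol already realizes the whole word. -/
theorem exists_of_mem_sequences {B : Type w} (e : C.sets ≃ B) {T : ℕ}
    {ζ : Fin (T + 1) → B} (hζ : ζ ∈ (blockCoder S α₀ e).sequences sys (T + 1)) :
    ∃ ξ : ℕ → X, ∀ i : Fin (T + 1), ζ i = e (C.codeSymbol S α₀ ξ i) := by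
  rcases T with _ | T
  · obtain ⟨x, hx⟩ := hζ.1 (Nat.succ_pos 0)
    refine ⟨fun _ => x 0, fun i => ?_⟩
    have hi : i = 0 := Subsingleton.elim (α := Fin 1) i 0
    rw [hi, ← symbols_blockCoder e (fun _ => x 0) 0 0]
    refine hx.symm.trans ?_
    have : x = fun _ => x 0 := funext fun k => congrArg x (Subsingleton.elim (α := Fin 1) k 0)
    rw [this]
    rfl
  · obtain ⟨p, -, hp, -⟩ := hζ.2 (Fin.last (T + 1)) (Nat.succ_pos T)
    refine ⟨p.1, fun i => ?_⟩
    rw [← symbols_blockCoder e p.1 (T + 1) i]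
    refine Eq.trans ?_ (congrFun hp i)
    exact (congrFun (Fin.snoc_init_self (α := fun _ => B) ζ) i).symm

theorem post_blockCoder_subset {B : Type w} (e : C.sets ≃ B) (hα₀ : α₀ ∈ S) {t : ℕ}
    {ζ : Fin (t + 1) → B} {ξ : ℕ → X} (hζ : ∀ i : Fin (t + 1), ζ i = e (C.codeSymbol S α₀ ξ i)) :
    (blockCoder S α₀ e).post sys (t + 1) ζ ⊆
      e '' C.succ S (C.codeState S α₀ ξ t) (blockPos m t) := by
  rintro s ⟨p, -, hp, -⟩
  have hag : ∀ i ≤ t, C.codeSymbol S α₀ ξ i = C.codeSymbol S α₀ p.1 i := by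
    intro i hi
    have h1 := congrFun hp (Fin.castSucc ⟨i, Nat.lt_succ_of_le hi⟩)
    rw [symbols_blockCoder] at h1
    refine e.injective ((hζ ⟨i, Nat.lt_succ_of_le hi⟩).symm.trans (Eq.trans ?_ h1))
    exact (Fin.snoc_castSucc (α := fun _ => B) s ζ _).symm
  have hlast := congrFun hp (Fin.last (t + 1))
  rw [symbols_blockCoder] at hlast
  replace hlast := (Fin.snoc_last (α := fun _ => B) s ζ).symm.trans hlast
  rw [succ_codeState_congr hα₀ hag]
  exact ⟨_, codeSymbol_succ_mem hα₀ p.1 t, hlast.symm⟩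

/-- The first symbol is charged for the whole alphabet, since `Z(∅) = S`; the other `T` steps are
rounded up to whole blocks. -/
theorem sum_logb_post_blockCoder_le {B : Type w} (e : C.sets ≃ B) (hα₀ : α₀ ∈ S) {T : ℕ}
    {ζ : Fin (T + 1) → B} (hζ : ζ ∈ (blockCoder S α₀ e).sequences sys (T + 1)) :
    ∑ t : Fin (T + 1),
      Real.logb 2 (((blockCoder S α₀ e).post sys t (restrict ζ t t.isLt.le)).ncard : ℝ) ≤
      Real.logb 2 ((Set.univ : Set B).ncard : ℝ) +
        (((T / (m + 1) + 1 : ℕ) : ℝ)) * Real.logb 2 (C.expansion S) := by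
  have : Finite C.sets := C.finite
  obtain ⟨ξ, hξ⟩ := exists_of_mem_sequences e hζ
  rw [Fin.sum_univ_succ]
  refine add_le_add le_rfl (le_trans ?_ (sum_logb_succ_codeState_le (C := C) hα₀ ξ _))
  have hnonneg : ∀ t, 0 ≤
      Real.logb 2 ((C.succ S (C.codeState S α₀ ξ t) (blockPos m t)).ncard : ℝ) := fun t =>
    Real.logb_nonneg one_lt_two (by exact_mod_cast ncard_succ_codeState_pos hα₀ ξ t)
  have hT : T ≤ (T / (m + 1) + 1) * (m + 1) := by
    have h1 := Nat.div_add_mod' T (m + 1)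
    have h2 : T % (m + 1) < m + 1 := Nat.mod_lt T (Nat.succ_pos m)
    rw [add_mul]
    omega
  refine le_trans ?_ (Finset.sum_le_sum_of_subset_of_nonneg
    (Finset.range_subset_range.2 hT) fun t _ _ => hnonneg t)
  rw [Finset.sum_range]
  refine Finset.sum_le_sum fun t _ => Real.logb_le_logb_of_le one_lt_two ?_ ?_
  · have hmem := hζ.2 t.succ (Nat.succ_pos _)
    have hfin : Finite (blockCoder S α₀ e).S := (blockCoder S α₀ e).finite
    exact_mod_cast (Set.ncard_pos (Set.toFinite _)).2 ⟨_, hmem⟩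
  · rw [Nat.cast_le, ← Set.ncard_image_of_injective _ e.injective]
    refine Set.ncard_le_ncard (post_blockCoder_subset e hα₀ fun i => ?_) ((Set.toFinite _).image _)
    exact hξ (Fin.castLE t.succ.isLt.le i)

theorem rate_blockCoder_le {B : Type w} (e : C.sets ≃ B) (hα₀ : α₀ ∈ S) {c : ℝ}
    (hc : (1 / ((m + 1 : ℕ) : ℝ)) * Real.logb 2 (C.expansion S) < c) :
    (blockCoder S α₀ e).rate sys ≤ c := by
  set L := Real.logb 2 (C.expansion S)
  set D := Real.logb 2 ((Set.univ : Set B).ncard : ℝ)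
  have : Finite C.sets := C.finite
  have hL : 0 ≤ L := by
    have := (Finset.prod_pos fun (t : Fin (m + 1)) _ => ?_).trans_le (C.le_expansion S α₀ hα₀)
    · exact Real.logb_nonneg one_lt_two (by exact_mod_cast this)
    · refine (Set.ncard_pos (Set.toFinite _)).2 ?_
      by_cases h : t.1 + 1 < m + 1
      · exact ⟨_, Or.inl ⟨h, α₀, hα₀, fun _ _ => rfl, rfl⟩⟩
      · exact ⟨_, Or.inr ⟨by have := t.isLt; omega, α₀, hα₀, Nat.succ_pos m, rfl⟩⟩
  have hD : 0 ≤ D := by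
    have : Finite B := Finite.of_equiv _ e
    exact Real.logb_nonneg one_lt_two (by
      exact_mod_cast (Set.ncard_pos (Set.toFinite _)).2 ⟨e (α₀ 0), Set.mem_univ _⟩)
  have hlim : Tendsto (fun T : ℕ => (1 / ((m + 1 : ℕ) : ℝ)) * L + (D + L) / (T : ℝ)) atTop
      (𝓝 ((1 / ((m + 1 : ℕ) : ℝ)) * L)) := by
    simpa using (tendsto_const_div_atTop_nhds_zero_nat (D + L)).const_add
      ((1 / ((m + 1 : ℕ) : ℝ)) * L)
  refine limsup_le_of_le (by isBoundedDefault) ?_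
  filter_upwards [hlim.eventually_lt_const hc, eventually_gt_atTop 0] with τ hτ hτ0
  obtain ⟨T, rfl⟩ := Nat.exists_eq_succ_of_ne_zero hτ0.ne'
  -- The second goal, nonnegativity of the bound, covers a possibly empty `sequences`, where the
  -- real supremum is `0`.
  refine EReal.coe_le_coe_iff.2 (Real.iSup_le (fun ζ => le_trans ?_ hτ.le) (le_trans ?_ hτ.le))
  · have h := sum_logb_post_blockCoder_le e hα₀ ζ.2
    have hpos : (0 : ℝ) < ((T + 1 : ℕ) : ℝ) := by positivity
    have hdiv : ((T / (m + 1) : ℕ) : ℝ) ≤ ((T + 1 : ℕ) : ℝ) / ((m + 1 : ℕ) : ℝ) :=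
      Nat.cast_div_le.trans (by gcongr; omega)
    rw [one_div_mul_eq_div, div_le_iff₀ hpos, add_mul, div_mul_cancel₀ _ hpos.ne']
    refine h.trans ?_
    have h2 := mul_le_mul_of_nonneg_right hdiv hL
    have h3 : 1 / ((m + 1 : ℕ) : ℝ) * L * ((T + 1 : ℕ) : ℝ) =
        ((T + 1 : ℕ) : ℝ) / ((m + 1 : ℕ) : ℝ) * L := by ring
    rw [h3, Nat.cast_add (T / (m + 1)) 1, Nat.cast_one, add_mul, one_mul]
    linarith
  · positivity

theorem iInf_rate_le_entropy (C : InvariantCover sys Q) (hQ : Q.Nonempty) :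
    (⨅ H : {H : CoderController.{w, u, v} X U // H.IsAdmissible sys Q}, H.1.rate sys) ≤
      (C.entropy : EReal) := by
  refine EReal.le_of_forall_lt_iff_le.1 fun c hc => ?_
  obtain ⟨τ, hτ, hτ0⟩ := (((C.tendsto_entropy hQ).eventually_lt_const
    (EReal.coe_lt_coe_iff.1 hc)).and (eventually_gt_atTop 0)).exists
  obtain ⟨m, rfl⟩ := Nat.exists_eq_succ_of_ne_zero hτ0.ne'
  obtain ⟨S, hS, hN⟩ := C.exists_spanning hτ0
  obtain ⟨α₀, hα₀⟩ := hS.nonempty hQ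
  have : Finite C.sets := C.finite
  -- Finiteness of the cover allows an alphabet in the prescribed universe `w`.
  let e : C.sets ≃ ULift.{w} (Fin (Nat.card C.sets)) :=
    (Finite.equivFin C.sets).trans Equiv.ulift.symm
  rw [hN] at hτ
  have hrate : (blockCoder S α₀ e).rate sys ≤ c := rate_blockCoder_le e hα₀ hτ
  exact iInf_le_of_le ⟨blockCoder S α₀ e, isAdmissible_blockCoder e hS hα₀⟩ hrate

end InvariantCover

theorem theorem5 {X : Type u} {U : Type v} [Nonempty X] [Nonempty U]
    (sys : ControlSystem X U) (Q : Set X) (hQ : Q.Nonempty) :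
    sys.hInv Q =
      ⨅ H : {H : CoderController.{w, u, v} X U // H.IsAdmissible sys Q}, H.1.rate sys := by
  refine le_antisymm (le_iInf fun H => CoderController.hInv_le_rate hQ H.2) ?_
  exact le_iInf fun C => C.iInf_rate_le_entropy hQ
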